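/- Let $\mathbb{S}^3\subset\mathbb{R}^4$ be the unit sphere with the round metric, Levi-Civita connection $\nabla$ and volume measure $\mathrm{vol}$. A Hopf vector field is a vector field of the form $H(x)=Jx$, where $J$ is a linear isometry of $\mathbb{R}^4$ with $J^2=-\mathrm{Id}$; equivalently, a smooth unit vector field tangent to the fibres of a Hopf fibration of $\mathbb{S}^3$. For a compact set $K$ contained in an open set $U\subseteq\mathbb{S}^3$ and a smooth unit vector field $v$ on $U$, let $$\mathrm{vol}_K(v)=\int_K\sqrt{\det\big(\langle e_i,e_j\rangle+\langle\nabla_{e_i}v,\nabla_{e_j}v\rangle\big)_{i,j=1}^{3}}\;d\mathrm{vol},$$ which is the three-dimensional volume of $v(K)$ in the unit tangent bundle $T^1\mathbb{S}^3$ with the Sasaki metric, and let $$\mathcal{E}_K(v)=\frac32\,\mathrm{vol}(K)+\frac12\int_K\sum_{i=1}^{3}\|\nabla_{e_i}v\|^2\,d\mathrm{vol},$$ where $e_1,e_2,e_3$ is any orthonormal basis of $T_x\mathbb{S}^3$. **Theorem.** Let $U\subseteq\mathbb{S}^3$ be open, let $K\subset U$ be compact, let $v$ be a smooth unit vector field on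 $U$, and let $H$ be a Hopf vector field with $v(x)=H(x)$ for every $x$ in the topological boundary $\partial K$ of $K$ in $\mathbb{S}^3$. Then $$\mathrm{vol}_K(v)\ge \mathrm{vol}_K(H)\qquad\text{and}\qquad \mathcal{E}_K(v)\ge\mathcal{E}_K(H).$$ -/

import Mathlib

open Set Metric MeasureTheory Manifold
open scoped ContDiff ENNReal

noncomputable section

/-- Euclidean four-space. -/
abbrev E4 : Type := EuclideanSpace ℝ (Fin 4)

/-- The unit sphere `S³` in Euclidean four-space, with Mathlib's smooth structure. -/
abbrev S3 : Type := sphere (0 : E4) 1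

instance fact_finrank_E4 : Fact (Module.finrank ℝ E4 = 3 + 1) :=
  ⟨by simp⟩

/-- The tangent space of `S³` at `x`, realised as the orthogonal complement of `x` in `E4`;
it carries the round metric, which is the restriction of the Euclidean inner product. -/
abbrev TanS3 (x : S3) : Submodule ℝ E4 := (Submodule.span ℝ {(x : E4)})ᗮ

/-- The identification of the abstract tangent space of the manifold `S³` at `x` with `x^⊥`,
given by the differential of the inclusion of `S³` into `E4`. -/
def tangentEquiv (x : S3) : TangentSpace (𝓡 3) x ≃ₗ[ℝ] TanS3 x :=
  (LinearEquiv.ofInjective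
    (mvfderiv (𝓡 3) ((↑) : S3 → E4) x).toLinearMap
    (injective_mvfderiv_subtypeVal_sphere (n := 3) x)).trans
  (LinearEquiv.ofEq _ _ (range_mvfderiv_subtypeVal (n := 3) x))

/-- The differential at `x` of a map `f` from `S³` to a normed space, evaluated on a tangent
vector `Y ∈ x^⊥`. -/
def sphereDeriv {F : Type} [NormedAddCommGroup F] [NormedSpace ℝ F]
    (f : S3 → F) (x : S3) (Y : TanS3 x) : F :=
  mvfderiv (𝓡 3) f x ((tangentEquiv x).symm Y)

/-- The orthogonal projection of `E4` onto the tangent space of `S³` at `x`. -/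
def tanProj (x w : E4) : E4 := w - (inner ℝ x w : ℝ) • x

/-- `v` is a smooth unit vector field on the open set `U ⊆ S³`; a vector field is regarded as a
map to `E4` that is tangent to `S³`. -/
structure IsUnitVectorFieldOn (v : S3 → E4) (U : Set S3) : Prop where
  smooth : ContMDiffOn (𝓡 3) 𝓘(ℝ, E4) ∞ v U
  tangent : ∀ x ∈ U, inner ℝ (x : E4) (v x) = 0
  unit : ∀ x ∈ U, ‖v x‖ = 1

/-- `H` is a Hopf vector field: `H x = J x` for an orthogonal complex structure `J` of `E4`.
The integral curves `t ↦ cos t • x + sin t • J x` are the great circles cut out of `S³` by the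
complex lines of `(E4, J)`, that is, the fibres of the Hopf fibration. All Hopf fibrations
(those congruent to the classical one by an isometry of `S³`), with both orientations of the
fibres, are obtained in this way. -/
def IsHopfField (H : S3 → E4) : Prop :=
  ∃ J : E4 →ₗᵢ[ℝ] E4, (∀ y, J (J y) = -y) ∧ ∀ x : S3, H x = J x

/-- The Levi-Civita covariant derivative `∇_Y v` on `S³` of the vector field `v` at `x`: the
tangential part of the derivative of `v` in `E4` (Gauss formula). -/
def covDeriv (v : S3 → E4) (x : S3) (Y : TanS3 x) : E4 :=
  tanProj x (sphereDeriv v x Y)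

/-- An orthonormal basis of the tangent space of `S³` at `x`. The quantities defined through it
below do not depend on the choice. -/
def frame (x : S3) : OrthonormalBasis (Fin 3) ℝ (TanS3 x) :=
  OrthonormalBasis.fromOrthogonalSpanSingleton 3 (ne_zero_of_mem_unit_sphere x)

/-- The volume measure of the round sphere `S³`. -/
def volS3 : Measure S3 := (volume : Measure E4).toSphere

/-- The Sasaki metric at the point `p = (x, ξ)` of the tangent bundle of `S³`, regarded as a
subset of `E4 × E4`. A tangent vector `A = (a, α)` at `p` has horizontal part `a` (its image under
the differential of the bundle projection) and vertical part `tanProj x α` (its image under the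
connection map: along a curve `(x(t), ξ(t))` this is the covariant derivative of `ξ`). The metric of
the unit tangent bundle is the restriction of this one. -/
def sasaki (p A B : E4 × E4) : ℝ :=
  inner ℝ A.1 B.1 + inner ℝ (tanProj p.1 A.2) (tanProj p.1 B.2)

/-- The vector field `v` regarded as a section `x ↦ (x, v x)` of the unit tangent bundle. -/
def sectionMap (v : S3 → E4) (x : S3) : E4 × E4 := ((x : E4), v x)

/-- The Gram matrix at `x`, in an orthonormal frame of `S³`, of the pull-back of the Sasaki metric
by the section `v`. -/
def sasakiGram (v : S3 → E4) (x : S3) : Matrix (Fin 3) (Fin 3) ℝ :=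
  Matrix.of fun i j => sasaki (sectionMap v x)
    (sphereDeriv (sectionMap v) x (frame x i)) (sphereDeriv (sectionMap v) x (frame x j))

/-- The volume of `v` over `K`: the three-dimensional volume, for the Sasaki metric, of the part
`v(K)` of the submanifold of the unit tangent bundle parametrised by the section `v`. -/
def volField (v : S3 → E4) (K : Set S3) : ℝ≥0∞ :=
  ∫⁻ x in K, ENNReal.ofReal (Real.sqrt (sasakiGram v x).det) ∂volS3

/-- The squared norm `‖∇v‖² = ∑ₐ ‖∇_{eₐ} v‖²` at `x`. -/
def normSqCovDeriv (v : S3 → E4) (x : S3) : ℝ :=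
  ∑ a : Fin 3, ‖covDeriv v x (frame x a)‖ ^ 2

/-- The energy of `v` over `K`: `(3/2) vol(K) + (1/2) ∫_K ‖∇v‖²`. -/
def energyField (v : S3 → E4) (K : Set S3) : ℝ≥0∞ :=
  (3 / 2) * volS3 K + (1 / 2) * ∫⁻ x in K, ENNReal.ofReal (normSqCovDeriv v x) ∂volS3

end

/-! This is a calibration argument. Let `σ = (tr ∇v)² - tr((∇v)²)`, twice the second elementary
symmetric function of `∇v`. Since `v` has unit length, the image of `∇v` lies in `v^⊥`; writing the
densities as sums of squares in an orthonormal basis ending with `v` gives `√det ≥ 1 + σ/2` and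
`‖∇v‖² ≥ σ` (`Matrix.twoSigma_bounds`). For a Hopf field `σ = 2` and both bounds are equalities.

It remains to see that `∫_K σ` depends only on `v` on `∂K` (`setIntegral_sigmaField_eq`). Extend `v`
and a competitor `w` to be constant along rays in `E4`, and put `S = v + w`, `W = v - w`. Then `σ(v)
- σ(w)` is the divergence of `(div S) W - (DS) W`, because the second derivatives of `S` cancel.
This field vanishes where `v = w`, and its radial component is `|v|² - |w|² = 0`, so a radial cutoff
produces no further term. Integrating over a shell over `K` and using polar coordinates gives the
claim.

As `∂K` is arbitrary, the divergence theorem is replaced by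
`setIntegral_fderiv_eq_zero_of_frontier`: truncating the small values of a function that vanishes on
the frontier makes its extension by zero differentiable. -/

/-! ### Integration by parts over a compact set with arbitrary frontier. -/

/-- A zero with nonzero derivative is isolated among the zeros, and the points of a subset of `ℝ`
isolated from the right within it are countable. -/
theorem countable_setOf_eq_zero_hasDerivAt_ne_zero (g : ℝ → ℝ) :
    {t | g t = 0 ∧ ∃ d ≠ 0, HasDerivAt g d t}.Countable := by
  set S := {t | g t = 0 ∧ ∃ d ≠ 0, HasDerivAt g d t} with hS
  refine (countable_setOfPred_isolated_right_within (s := S)).mono ?_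
  intro x hx
  obtain ⟨hx0, d, hd, hg⟩ := hx
  have h1 : ∀ᶠ z in nhdsWithin x (S ∩ Ioi x), g z ≠ 0 :=
    (hg.eventually_ne (c := 0) hd).filter_mono (nhdsWithin_mono _ fun y hy => ne_of_gt hy.2)
  have h2 : nhdsWithin x (S ∩ Ioi x) = ⊥ := by
    rw [← Filter.eventually_false_iff_eq_bot]
    filter_upwards [h1, self_mem_nhdsWithin] with z hz hz'
    exact hz hz'.1.1
  exact ⟨⟨hx0, d, hd, hg⟩, h2⟩

section

variable {E : Type*} [NormedAddCommGroup E] [NormedSpace ℝ E] [FiniteDimensional ℝ E]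
  [MeasurableSpace E] [BorelSpace E] (μ : Measure E) [μ.IsAddHaarMeasure]

/-- By Fubini it suffices to look at lines parallel to `u`; on each of them the exceptional set is
countable. -/
theorem ae_fderiv_apply_eq_zero_of_eq_zero {f : E → ℝ} {Ω : Set E} (hΩ : IsOpen Ω)
    (hf : DifferentiableOn ℝ f Ω) (u : E) :
    ∀ᵐ x ∂μ, x ∈ Ω → f x = 0 → fderiv ℝ f x u = 0 := by
  set N : Set E := {x | x ∈ Ω → f x = 0 → fderiv ℝ f x u = 0} with hN
  have hmeas : MeasurableSet N := by
    have h1 : IsOpen (Ω ∩ f ⁻¹' {0}ᶜ) :=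
      hf.continuousOn.isOpen_inter_preimage hΩ isOpen_compl_singleton
    have h2 : MeasurableSet {x | fderiv ℝ f x u = 0} :=
      measurableSet_eq_fun (measurable_fderiv_apply_const ℝ f u) measurable_const
    have : N = Ωᶜ ∪ (Ω ∩ f ⁻¹' {0}ᶜ) ∪ {x | fderiv ℝ f x u = 0} := by
      ext x
      simp only [hN, mem_ofPred_eq, mem_union, mem_compl_iff, mem_inter_iff, mem_preimage,
        mem_singleton_iff]
      tauto
    rw [this]
    exact (hΩ.measurableSet.compl.union h1.measurableSet).union h2
  refine ae_mem_of_ae_add_linearMap_mem (LinearMap.toSpanSingleton ℝ E u) volume μ hmeas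
    fun y => ?_
  rw [ae_iff]
  refine measure_mono_null ?_
    ((countable_setOf_eq_zero_hasDerivAt_ne_zero fun t : ℝ => f (y + t • u)).measure_zero volume)
  intro t ht
  replace ht : ¬(y + t • u ∈ Ω → f (y + t • u) = 0 → fderiv ℝ f (y + t • u) u = 0) := ht
  simp only [Classical.not_imp] at ht
  obtain ⟨h1, h2, h3⟩ := ht
  refine ⟨h2, _, h3, ?_⟩
  have hd : HasFDerivAt f (fderiv ℝ f (y + t • u)) (y + t • u) :=
    (hf.differentiableAt (hΩ.mem_nhds h1)).hasFDerivAt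
  have hl : HasDerivAt (fun t : ℝ => y + t • u) u t := by
    simpa using ((hasDerivAt_id t).smul_const u).const_add y
  exact hd.comp_hasDerivAt t hl

/-- The integral of a directional derivative of an integrable everywhere differentiable function
vanishes. -/
theorem integral_fderiv_apply_eq_zero {f : E → ℝ} (u : E) (hf : Differentiable ℝ f)
    (hi : Integrable f μ) (hi' : Integrable (fun x => fderiv ℝ f x u) μ) :
    ∫ x, fderiv ℝ f x u ∂μ = 0 := by
  have := integral_mul_fderiv_eq_neg_fderiv_mul_of_integrable (μ := μ) (f := fun _ : E => (1 : ℝ))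
    (g := f) (v := u) (by simp) (by simpa using hi') (by simpa using hi)
    (fun x _ => differentiableAt_const _) (fun x _ => hf x)
  simpa using this

/-- A smooth function that vanishes near `0` and has derivative `1` far from `0`. -/
theorem exists_truncation : ∃ k : ℝ → ℝ, ContDiff ℝ 1 k ∧ (∀ t, |t| ≤ 1 → k t = 0) ∧
    (∀ t, 2 < |t| → deriv k t = 1) ∧ (∃ B, ∀ t, |deriv k t| ≤ B) := by
  have hk : ContDiff ℝ 1 fun t : ℝ => t * Real.smoothTransition (t ^ 2 - 1) :=
    contDiff_id.mul (Real.smoothTransition.contDiff.comp (by fun_prop))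
  have hfar : ∀ t : ℝ, 2 < |t| →
      deriv (fun t : ℝ => t * Real.smoothTransition (t ^ 2 - 1)) t = 1 := by
    intro t ht
    have : (fun t : ℝ => t * Real.smoothTransition (t ^ 2 - 1)) =ᶠ[nhds t] fun t => t := by
      filter_upwards [(isOpen_lt continuous_const continuous_abs).mem_nhds ht] with s hs
      have : (1 : ℝ) ≤ s ^ 2 - 1 := by
        have := sq_abs s
        nlinarith [show 2 < |s| from hs]
      simp [Real.smoothTransition.one_of_one_le this]
    rw [this.deriv_eq, deriv_id'']
  refine ⟨_, hk, fun t ht => ?_, hfar, ?_⟩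
  · have : t ^ 2 - 1 ≤ 0 := by
      have := sq_abs t
      nlinarith [abs_nonneg t]
    simp [Real.smoothTransition.zero_of_nonpos this]
  · obtain ⟨B, hB⟩ := (isCompact_Icc (a := (-2 : ℝ)) (b := 2)).exists_bound_of_continuousOn
      (hk.continuous_deriv le_rfl).continuousOn
    refine ⟨max B 1, fun t => ?_⟩
    rcases lt_or_ge 2 |t| with ht | ht
    · rw [hfar t ht]; simp
    · exact (hB t (abs_le.1 ht)).trans (le_max_left _ _)

/-- If a `C¹` function vanishes on the frontier of a compact set, then the integral of each of its
directional derivatives over the compact set is zero; no regularity of the frontier is needed. -/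
theorem setIntegral_fderiv_eq_zero_of_frontier {f : E → ℝ} {Ω C : Set E} (hΩ : IsOpen Ω)
    (hC : IsCompact C) (hCΩ : C ⊆ Ω) (hf : ContDiffOn ℝ 1 f Ω) (h0 : ∀ x ∈ frontier C, f x = 0)
    (u : E) : ∫ x in C, fderiv ℝ f x u ∂μ = 0 := by
  obtain ⟨k, hk, hk0, hk1, B, hB⟩ := exists_truncation
  have hfd : ∀ x ∈ Ω, DifferentiableAt ℝ f x := fun x hx =>
    (hf.differentiableOn one_ne_zero).differentiableAt (hΩ.mem_nhds hx)
  have hf' : ContinuousOn (fun x => fderiv ℝ f x u) C :=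
    ((hf.continuousOn_fderiv_of_isOpen hΩ le_rfl).mono hCΩ).clm_apply continuousOn_const
  have hfC : ContinuousOn f C := hf.continuousOn.mono hCΩ
  have hCm := hC.measurableSet
  have hkd : ∀ t, HasDerivAt k (deriv k t) t := fun t =>
    (hk.differentiable one_ne_zero t).hasDerivAt
  have hk'0 : deriv k 0 = 0 := by
    have : k =ᶠ[nhds 0] fun _ => 0 := by
      filter_upwards [ball_mem_nhds (0 : ℝ) one_pos] with t ht
      exact hk0 t (by simpa using (mem_ball_zero_iff.1 ht).le)
    rw [this.deriv_eq]; simp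
  set a : ℕ → ℝ := fun n => n + 1 with ha
  have hapos : ∀ n, 0 < a n := fun n => by positivity
  -- The rescaled truncation `k(a t)/a` vanishes for `|t| ≤ 1/a` and has slope `1` for `|t| > 2/a`.
  -- Composed with `f` it is zero near each frontier point, so cutting off by the indicator of `C`
  -- stays differentiable.
  set g : ℕ → E → ℝ := fun n => C.indicator fun x => (a n)⁻¹ * k (a n * f x) with hg
  set D : ℕ → E → ℝ := fun n => C.indicator fun x => deriv k (a n * f x) * fderiv ℝ f x u with hD
  have hin : ∀ n, ∀ x ∈ Ω, HasFDerivAt (fun x => (a n)⁻¹ * k (a n * f x))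
      (deriv k (a n * f x) • fderiv ℝ f x) x := by
    intro n x hx
    have h1 := ((hkd (a n * f x)).comp_hasFDerivAt x
      ((hfd x hx).hasFDerivAt.const_mul (a n))).const_mul (a n)⁻¹
    have h2 : (a n)⁻¹ • deriv k (a n * f x) • a n • fderiv ℝ f x =
        deriv k (a n * f x) • fderiv ℝ f x := by
      rw [smul_smul, smul_smul, mul_right_comm, inv_mul_cancel₀ (hapos n).ne', one_mul]
    rw [← h2]
    exact h1
  have hder : ∀ n x, DifferentiableAt ℝ (g n) x ∧ fderiv ℝ (g n) x u = D n x := by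
    intro n x
    by_cases hxC : x ∈ C
    · by_cases hxi : x ∈ interior C
      · have : HasFDerivAt (g n) (deriv k (a n * f x) • fderiv ℝ f x) x := by
          refine (hin n x (hCΩ hxC)).congr_of_eventuallyEq ?_
          filter_upwards [isOpen_interior.mem_nhds hxi] with y hy
          simp [hg, indicator_of_mem (interior_subset hy)]
        refine ⟨this.differentiableAt, ?_⟩
        rw [this.fderiv]
        simp [hD, hxC]
      · have hx0 : f x = 0 := h0 x ⟨subset_closure hxC, hxi⟩
        have : HasFDerivAt (g n) (0 : E →L[ℝ] ℝ) x := by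
          refine (hasFDerivAt_const (0 : ℝ) x).congr_of_eventuallyEq ?_
          have hc : ContinuousAt (fun y => a n * f y) x :=
            continuousAt_const.mul (hfd x (hCΩ hxC)).continuousAt
          have hb : ball (0 : ℝ) 1 ∈ nhds (a n * f x) := by
            rw [hx0, mul_zero]; exact ball_mem_nhds _ one_pos
          filter_upwards [hc hb] with y hy
          have : k (a n * f y) = 0 := hk0 _ (by simpa using (mem_ball_zero_iff.1 hy).le)
          by_cases hyC : y ∈ C <;> simp [hg, hyC, this]
        refine ⟨this.differentiableAt, ?_⟩
        rw [this.fderiv]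
        simp [hD, hxC, hx0, hk'0]
    · have : HasFDerivAt (g n) (0 : E →L[ℝ] ℝ) x := by
        refine (hasFDerivAt_const (0 : ℝ) x).congr_of_eventuallyEq ?_
        filter_upwards [hC.isClosed.isOpen_compl.mem_nhds hxC] with y hy
        simp [hg, indicator_of_notMem hy]
      refine ⟨this.differentiableAt, ?_⟩
      rw [this.fderiv]
      simp [hD, hxC]
  have hDi : ∀ n, Integrable (D n) μ := fun n =>
    (integrable_indicator_iff hCm).2
      ((((hk.continuous_deriv le_rfl).comp_continuousOn
        (continuousOn_const.mul hfC)).mul hf').integrableOn_compact hC)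
  have hgi : ∀ n, Integrable (g n) μ := fun n =>
    (integrable_indicator_iff hCm).2
      ((continuousOn_const.mul (hk.continuous.comp_continuousOn
        (continuousOn_const.mul hfC))).integrableOn_compact hC)
  have hzero : ∀ n, ∫ x, D n x ∂μ = 0 := by
    intro n
    have h1 : (fun x => fderiv ℝ (g n) x u) = D n := funext fun x => (hder n x).2
    rw [← h1]
    exact integral_fderiv_apply_eq_zero μ u (fun x => (hder n x).1) (hgi n) (h1 ▸ hDi n)
  have hf'i : Integrable (C.indicator fun x => fderiv ℝ f x u) μ :=
    (integrable_indicator_iff hCm).2 (hf'.integrableOn_compact hC)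
  rw [← integral_indicator hCm]
  have hlim : Filter.Tendsto (fun n => ∫ x, D n x ∂μ) Filter.atTop
      (nhds (∫ x, C.indicator (fun x => fderiv ℝ f x u) x ∂μ)) := by
    refine tendsto_integral_of_dominated_convergence
      (fun x => B * ‖C.indicator (fun x => fderiv ℝ f x u) x‖)
      (fun n => (hDi n).aestronglyMeasurable) (hf'i.norm.const_mul B) (fun n => ?_) ?_
    · refine Filter.Eventually.of_forall fun x => ?_
      by_cases hx : x ∈ C
      · simp only [hD, indicator_of_mem hx, norm_mul]
        exact mul_le_mul_of_nonneg_right (hB _) (norm_nonneg _)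
      · simp [hD, hx]
    -- Where `f ≠ 0` the sequence is eventually equal to its limit; where `f = 0` the derivative of
    -- `f` is zero almost everywhere.
    · filter_upwards [ae_fderiv_apply_eq_zero_of_eq_zero μ hΩ
        (hf.differentiableOn one_ne_zero) u] with x hx
      by_cases hxC : x ∈ C
      · simp only [hD, indicator_of_mem hxC]
        by_cases hfx : f x = 0
        · simp [hx (hCΩ hxC) hfx]
        · refine tendsto_const_nhds.congr' ?_
          obtain ⟨N, hN⟩ := exists_nat_gt (2 / |f x|)
          filter_upwards [Filter.eventually_ge_atTop N] with n hn
          rw [hk1, one_mul]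
          rw [abs_mul, abs_of_pos (hapos n)]
          have hp : 0 < |f x| := abs_pos.2 hfx
          rw [div_lt_iff₀ hp] at hN
          refine hN.trans_le (mul_le_mul_of_nonneg_right ?_ hp.le)
          have : (N : ℝ) ≤ n := by exact_mod_cast hn
          simp only [ha]; linarith
      · simp [hD, hxC]
  simp only [hzero] at hlim
  exact (tendsto_nhds_unique hlim tendsto_const_nhds)

end

/-! ### Extension of fields from the sphere to cones in `E4`. -/

theorem norm_S3 (x : S3) : ‖(x : E4)‖ = 1 := by simp

/-- The radial projection of `E4` onto `S³`, with an arbitrary value at the origin. -/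
noncomputable def radialProj (x : E4) : S3 :=
  if h : x = 0 then ⟨EuclideanSpace.single 0 1, by simp⟩
  else ⟨‖x‖⁻¹ • x, by simp [norm_smul, h]⟩

theorem coe_radialProj {x : E4} (hx : x ≠ 0) : (radialProj x : E4) = ‖x‖⁻¹ • x := by
  simp [radialProj, hx]

theorem radialProj_coe (x : S3) : radialProj (x : E4) = x := by
  ext1
  rw [coe_radialProj (ne_zero_of_mem_unit_sphere x)]
  simp [norm_S3 x]

theorem radialProj_smul {r : ℝ} (hr : 0 < r) (x : E4) : radialProj (r • x) = radialProj x := by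
  by_cases hx : x = 0
  · simp [hx]
  · ext1
    rw [coe_radialProj (smul_ne_zero hr.ne' hx), coe_radialProj hx, norm_smul, smul_smul,
      Real.norm_of_nonneg hr.le]
    congr 1
    field_simp

theorem norm_smul_radialProj (x : E4) : ‖x‖ • (radialProj x : E4) = x := by
  by_cases hx : x = 0
  · simp [hx]
  · rw [coe_radialProj hx, smul_smul, mul_inv_cancel₀ (norm_ne_zero_iff.2 hx), one_smul]

theorem contMDiffAt_radialProj {x : E4} (hx : x ≠ 0) :
    ContMDiffAt 𝓘(ℝ, E4) (𝓡 3) ∞ radialProj x := by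
  -- `ContMDiff.codRestrict_sphere` needs a globally smooth map, so the punctured space is used as a
  -- manifold in its own right.
  let V : TopologicalSpace.Opens E4 := ⟨{0}ᶜ, isOpen_compl_singleton⟩
  have h1 : ContMDiff 𝓘(ℝ, E4) 𝓘(ℝ, E4) ∞ fun y : V => ‖(y : E4)‖⁻¹ • (y : E4) := by
    intro y
    have hy : (y : E4) ≠ 0 := y.2
    refine (contMDiffAt_subtype_iff (f := fun y : E4 => ‖y‖⁻¹ • y) (U := V)).2 ?_
    exact (((contDiffAt_norm ℝ hy).inv (norm_ne_zero_iff.2 hy)).smul contDiffAt_id).contMDiffAt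
  have h2 : ContMDiff 𝓘(ℝ, E4) (𝓡 3) ∞ fun y : V => radialProj y := by
    have hm : ∀ y : V, ‖(y : E4)‖⁻¹ • (y : E4) ∈ sphere (0 : E4) 1 := fun y => by
      have hy : (y : E4) ≠ 0 := y.2
      simp [norm_smul, hy]
    have he : (fun y : V => radialProj y) =
        Set.codRestrict (fun y : V => ‖(y : E4)‖⁻¹ • (y : E4)) _ hm := by
      ext1 y
      exact Subtype.ext (coe_radialProj y.2)
    rw [he]
    exact h1.codRestrict_sphere (n := 3) hm
  exact contMDiffAt_subtype_iff.1 (h2 ⟨x, hx⟩)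

theorem continuousAt_radialProj {x : E4} (hx : x ≠ 0) : ContinuousAt radialProj x :=
  (contMDiffAt_radialProj hx).continuousAt

/-- The extension of a map on `S³` to `E4`, constant along the open rays from the origin. -/
noncomputable def radialExt (v : S3 → E4) (x : E4) : E4 := v (radialProj x)

/-- The open cone over a subset of `S³`. -/
def coneOver (U : Set S3) : Set E4 := {x | x ≠ 0 ∧ radialProj x ∈ U}

theorem coe_mem_coneOver {U : Set S3} {x : S3} (hx : x ∈ U) : (x : E4) ∈ coneOver U :=
  ⟨ne_zero_of_mem_unit_sphere x, by rwa [radialProj_coe]⟩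

theorem isOpen_coneOver {U : Set S3} (hU : IsOpen U) : IsOpen (coneOver U) := by
  have h : ContinuousOn radialProj {0}ᶜ := fun x hx =>
    (continuousAt_radialProj hx).continuousWithinAt
  exact h.isOpen_inter_preimage isOpen_compl_singleton hU

theorem contDiffOn_radialExt {v : S3 → E4} {U : Set S3} (hU : IsOpen U)
    (hv : ContMDiffOn (𝓡 3) 𝓘(ℝ, E4) ∞ v U) : ContDiffOn ℝ ∞ (radialExt v) (coneOver U) := by
  intro x hx
  have h1 : ContMDiffAt (𝓡 3) 𝓘(ℝ, E4) ∞ v (radialProj x) := hv.contMDiffAt (hU.mem_nhds hx.2)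
  exact (h1.comp x (contMDiffAt_radialProj hx.1)).contDiffAt.contDiffWithinAt

theorem mvfderiv_coe_tangentEquiv_symm (x : S3) (Y : TanS3 x) :
    mvfderiv (𝓡 3) ((↑) : S3 → E4) x ((tangentEquiv x).symm Y) = (Y : E4) := by
  have h : ∀ Z : TangentSpace (𝓡 3) x,
      ((tangentEquiv x Z : TanS3 x) : E4) = mvfderiv (𝓡 3) ((↑) : S3 → E4) x Z := fun Z => rfl
  rw [← h, LinearEquiv.apply_symm_apply]

theorem sphereDeriv_eq_fderiv {F : Type} [NormedAddCommGroup F] [NormedSpace ℝ F] {f : S3 → F}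
    {G : E4 → F} {x : S3} (hG : DifferentiableAt ℝ G x) (hf : ∀ y : S3, f y = G y)
    (Y : TanS3 x) : sphereDeriv f x Y = fderiv ℝ G x Y := by
  obtain rfl : f = G ∘ ((↑) : S3 → E4) := funext hf
  have hc : MDifferentiableAt (𝓡 3) 𝓘(ℝ, E4) ((↑) : S3 → E4) x :=
    (contMDiff_coe_sphere (n := 3) (m := 1) x).mdifferentiableAt one_ne_zero
  rw [← mvfderiv_coe_tangentEquiv_symm x Y, sphereDeriv]
  have hG' : MDifferentiableAt 𝓘(ℝ, E4) 𝓘(ℝ, F) G (x : E4) := hG.mdifferentiableAt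
  refine (mfderiv_comp_apply (I := 𝓡 3) (I' := 𝓘(ℝ, E4)) (I'' := 𝓘(ℝ, F)) x hG' hc _).trans ?_
  rw [mfderiv_eq_fderiv]
  rfl

theorem sphereDeriv_eq_fderiv_radialExt {v : S3 → E4} {x : S3}
    (hv : DifferentiableAt ℝ (radialExt v) x) (Y : TanS3 x) :
    sphereDeriv v x Y = fderiv ℝ (radialExt v) x Y :=
  sphereDeriv_eq_fderiv hv (fun y => by rw [radialExt, radialProj_coe]) Y

theorem sphereDeriv_sectionMap {v : S3 → E4} {x : S3}
    (hv : DifferentiableAt ℝ (radialExt v) x) (Y : TanS3 x) :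
    sphereDeriv (sectionMap v) x Y = ((Y : E4), fderiv ℝ (radialExt v) x Y) := by
  rw [sphereDeriv_eq_fderiv (G := fun y => (y, radialExt v y)) (differentiableAt_id.prodMk hv)
    (fun y => by rw [radialExt, radialProj_coe, sectionMap])]
  exact congrArg (fun L => L (Y : E4))
    ((hasFDerivAt_id (𝕜 := ℝ) (x : E4)).prodMk hv.hasFDerivAt).fderiv

theorem fderiv_radialExt_smul (v : S3 → E4) {r : ℝ} (hr : 0 < r) (x : E4) :
    fderiv ℝ (radialExt v) (r • x) = r⁻¹ • fderiv ℝ (radialExt v) x := by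
  have h : radialExt v = fun y => radialExt v (r • y) := by
    ext1 y
    rw [radialExt, radialExt, radialProj_smul hr]
  have h2 := fderiv_comp_smul (𝕜 := ℝ) (f := radialExt v) (x := x) r
  rw [← h] at h2
  rw [h2, smul_smul, inv_mul_cancel₀ hr.ne', one_smul]

theorem fderiv_radialExt_self (v : S3 → E4) {x : E4}
    (hv : DifferentiableAt ℝ (radialExt v) x) : fderiv ℝ (radialExt v) x x = 0 := by
  have h1 : HasDerivAt (fun t : ℝ => radialExt v (t • x)) (fderiv ℝ (radialExt v) x x) 1 := by
    have hl : HasDerivAt (fun t : ℝ => t • x) x 1 := by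
      simpa using (hasDerivAt_id (1 : ℝ)).smul_const x
    have hv' : HasFDerivAt (radialExt v) (fderiv ℝ (radialExt v) x) ((1 : ℝ) • x) := by
      rw [one_smul]; exact hv.hasFDerivAt
    exact hv'.comp_hasDerivAt 1 hl
  have h2 : (fun t : ℝ => radialExt v (t • x)) =ᶠ[nhds 1] fun _ => radialExt v x := by
    filter_upwards [lt_mem_nhds (zero_lt_one' ℝ)] with t ht
    rw [radialExt, radialExt, radialProj_smul ht]
  rw [← h1.deriv, h2.deriv_eq, deriv_const]

section

variable {v : S3 → E4} {U : Set S3}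

theorem IsUnitVectorFieldOn.inner_radialExt (hv : IsUnitVectorFieldOn v U) {x : E4}
    (hx : x ∈ coneOver U) : inner ℝ x (radialExt v x) = 0 := by
  have := hv.tangent _ hx.2
  rw [coe_radialProj hx.1, real_inner_smul_left] at this
  exact (mul_eq_zero.1 this).resolve_left (inv_ne_zero (norm_ne_zero_iff.2 hx.1))

theorem IsUnitVectorFieldOn.norm_radialExt (hv : IsUnitVectorFieldOn v U) {x : E4}
    (hx : x ∈ coneOver U) : ‖radialExt v x‖ = 1 :=
  hv.unit _ hx.2

theorem IsUnitVectorFieldOn.differentiableAt (hv : IsUnitVectorFieldOn v U) (hU : IsOpen U)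
    {x : E4} (hx : x ∈ coneOver U) : DifferentiableAt ℝ (radialExt v) x :=
  ((contDiffOn_radialExt hU hv.smooth).contDiffAt
    ((isOpen_coneOver hU).mem_nhds hx)).differentiableAt (by simp)

/-- Differentiate `⟨x, S x⟩ = 0`. This turns the radial component of the null field into an
expression without derivatives. -/
theorem inner_fderiv_of_orthogonal {S : E4 → E4} {Ω : Set E4} (hΩ : IsOpen Ω)
    (h0 : ∀ x ∈ Ω, inner ℝ x (S x) = 0) {x : E4} (hx : x ∈ Ω) (hS : DifferentiableAt ℝ S x)
    (y : E4) : inner ℝ x (fderiv ℝ S x y) = - inner ℝ y (S x) := by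
  have h1 := (hasFDerivAt_id x).inner ℝ hS.hasFDerivAt
  have h2 : (fun z => inner ℝ (id z) (S z)) =ᶠ[nhds x] fun _ => (0 : ℝ) := by
    filter_upwards [hΩ.mem_nhds hx] with z hz using h0 z hz
  have h3 := congrArg (fun L => L y) (h1.unique
    ((hasFDerivAt_const (0 : ℝ) x).congr_of_eventuallyEq h2))
  simp at h3
  linarith

theorem IsUnitVectorFieldOn.inner_fderiv (hv : IsUnitVectorFieldOn v U) (hU : IsOpen U)
    {x : E4} (hx : x ∈ coneOver U) (y : E4) :
    inner ℝ (radialExt v x) (fderiv ℝ (radialExt v) x y) = 0 := by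
  have hd := (hv.differentiableAt hU hx).hasFDerivAt
  have h1 := hd.inner ℝ hd
  have h2 : (fun z => inner ℝ (radialExt v z) (radialExt v z)) =ᶠ[nhds x] fun _ => (1 : ℝ) := by
    filter_upwards [(isOpen_coneOver hU).mem_nhds hx] with z hz
    rw [real_inner_self_eq_norm_sq, hv.norm_radialExt hz, one_pow]
  have h3 := congrArg (fun L => L y) (h1.unique
    ((hasFDerivAt_const (1 : ℝ) x).congr_of_eventuallyEq h2))
  simp [real_inner_comm] at h3
  exact h3

end

/-! ### The null Lagrangian identity. -/

/-- The polarisation `tr A tr B - tr (A B)` of twice the second elementary symmetric function of an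
endomorphism. -/
noncomputable def polarSigma (A B : E4 →L[ℝ] E4) : ℝ :=
  LinearMap.trace ℝ E4 A * LinearMap.trace ℝ E4 B - LinearMap.trace ℝ E4 (A ∘L B : E4 →L[ℝ] E4)

/-- The standard basis vectors of `E4`. -/
noncomputable abbrev stdVec (i : Fin 4) : E4 := EuclideanSpace.single i 1

theorem sum_smul_stdVec (y : E4) : ∑ j, y j • stdVec j = y := by
  ext k
  simp [Finset.sum_apply, Pi.single_apply]

theorem apply_eq_sum_stdVec (A : E4 →L[ℝ] E4) (y : E4) : A y = ∑ j, y j • A (stdVec j) := by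
  conv_lhs => rw [← sum_smul_stdVec y]
  simp only [map_sum, map_smul]

theorem trace_eq_sum_stdVec (A : E4 →L[ℝ] E4) :
    LinearMap.trace ℝ E4 A = ∑ i, A (stdVec i) i := by
  rw [LinearMap.trace_eq_sum_inner _ (EuclideanSpace.basisFun (Fin 4) ℝ)]
  simp [EuclideanSpace.inner_single_left]

theorem polarSigma_eq_sum (A B : E4 →L[ℝ] E4) :
    polarSigma A B = ∑ i, ∑ j, (A (stdVec j) j * B (stdVec i) i - A (stdVec j) i * B (stdVec i) j) := by
  have h : ∀ i, (A ∘L B) (stdVec i) i = ∑ j, A (stdVec j) i * B (stdVec i) j := by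
    intro i
    rw [ContinuousLinearMap.comp_apply, apply_eq_sum_stdVec A]
    simp [Finset.sum_apply, mul_comm]
  rw [polarSigma, trace_eq_sum_stdVec, trace_eq_sum_stdVec, trace_eq_sum_stdVec]
  simp only [h, Finset.sum_sub_distrib, Finset.sum_mul, Finset.mul_sum]

/-- Difference of squares for a symmetric bilinear form; it expresses `σ(v) - σ(w)` through `S = v +
w` and `W = v - w`. -/
theorem polarSigma_add_sub (A B : E4 →L[ℝ] E4) :
    polarSigma (A + B) (A - B) = polarSigma A A - polarSigma B B := by
  simp only [polarSigma_eq_sum, ← Finset.sum_sub_distrib]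
  have h : ∀ i j, (A + B) (stdVec j) j * (A - B) (stdVec i) i
        - (A + B) (stdVec j) i * (A - B) (stdVec i) j
      = (A (stdVec j) j * A (stdVec i) i - A (stdVec j) i * A (stdVec i) j
        - (B (stdVec j) j * B (stdVec i) i - B (stdVec j) i * B (stdVec i) j))
        + ((B (stdVec j) j * A (stdVec i) i - A (stdVec j) j * B (stdVec i) i)
        - (B (stdVec j) i * A (stdVec i) j - A (stdVec j) i * B (stdVec i) j)) := by
    intro i j
    simp only [add_apply, sub_apply, PiLp.add_apply, PiLp.sub_apply]
    ring
  simp only [h, Finset.sum_add_distrib, add_eq_left, Finset.sum_sub_distrib]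
  have h1 : ∑ i, ∑ j, B (stdVec j) j * A (stdVec i) i = ∑ i, ∑ j, A (stdVec j) j * B (stdVec i) i := by
    rw [Finset.sum_comm]
    exact Finset.sum_congr rfl fun i _ => Finset.sum_congr rfl fun j _ => mul_comm _ _
  have h2 : ∑ i, ∑ j, B (stdVec j) i * A (stdVec i) j = ∑ i, ∑ j, A (stdVec j) i * B (stdVec i) j := by
    rw [Finset.sum_comm]
    exact Finset.sum_congr rfl fun i _ => Finset.sum_congr rfl fun j _ => mul_comm _ _
  rw [h1, h2]
  ring

/-- The components of the vector field `(div S) W - (∇S) W`. -/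
noncomputable def nullField (S W : E4 → E4) (i : Fin 4) (x : E4) : ℝ :=
  ∑ j, (fderiv ℝ S x (stdVec j) j * W x i - fderiv ℝ S x (stdVec j) i * W x j)

/-- No derivative of `W` enters, which is why agreement of the values on the frontier is enough. -/
theorem nullField_of_eq_zero {S W : E4 → E4} {x : E4} (h : W x = 0) (i : Fin 4) :
    nullField S W i x = 0 := by
  simp [nullField, h]

theorem sum_mul_nullField {S W : E4 → E4} (x : E4) :
    ∑ i, x i * nullField S W i x =
      LinearMap.trace ℝ E4 (fderiv ℝ S x) * inner ℝ x (W x)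
        - inner ℝ x (fderiv ℝ S x (W x)) := by
  have h : ∀ i, fderiv ℝ S x (W x) i = ∑ j, fderiv ℝ S x (stdVec j) i * W x j := fun i => by
    rw [apply_eq_sum_stdVec]
    simp [Finset.sum_apply, mul_comm]
  simp only [nullField, Finset.sum_sub_distrib, mul_sub, ← h, trace_eq_sum_stdVec,
    PiLp.inner_apply, ← Finset.sum_mul]
  simp only [Finset.mul_sum, Finset.sum_mul, RCLike.inner_apply, conj_trivial]
  congr 1
  · exact Finset.sum_congr rfl fun i _ => Finset.sum_congr rfl fun j _ => by ring
  · exact Finset.sum_congr rfl fun i _ => by ring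

theorem contDiffOn_nullField {S W : E4 → E4} {Ω : Set E4} (hΩ : IsOpen Ω)
    (hS : ContDiffOn ℝ 2 S Ω) (hW : ContDiffOn ℝ 2 W Ω) (i : Fin 4) :
    ContDiffOn ℝ 1 (nullField S W i) Ω := by
  have h1 : ∀ j k, ContDiffOn ℝ 1 (fun x => fderiv ℝ S x (stdVec j) k) Ω := fun j k =>
    (EuclideanSpace.proj (𝕜 := ℝ) k).contDiff.comp_contDiffOn
      ((hS.fderiv_of_isOpen hΩ (m := 1) (by norm_num)).clm_apply contDiffOn_const)
  have h2 : ∀ k, ContDiffOn ℝ 1 (fun x => W x k) Ω := fun k =>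
    (EuclideanSpace.proj (𝕜 := ℝ) k).contDiff.comp_contDiffOn (hW.of_le (by norm_num))
  exact ContDiffOn.sum fun j _ => ((h1 j j).mul (h2 i)).sub ((h1 j i).mul (h2 j))

/-- The divergence of `(div S) W - (∇S) W` contains no second derivatives. -/
theorem sum_fderiv_nullField {S W : E4 → E4} {x : E4} (hS : ContDiffAt ℝ 2 S x)
    (hW : DifferentiableAt ℝ W x) :
    ∑ i, fderiv ℝ (nullField S W i) x (stdVec i) = polarSigma (fderiv ℝ S x) (fderiv ℝ W x) := by
  have hS' : HasFDerivAt (fderiv ℝ S) (fderiv ℝ (fderiv ℝ S) x) x :=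
    ((hS.fderiv_right (m := 1) (by norm_num)).differentiableAt one_ne_zero).hasFDerivAt
  have hsymm : ∀ u w, fderiv ℝ (fderiv ℝ S) x u w = fderiv ℝ (fderiv ℝ S) x w u := fun u w =>
    hS.isSymmSndFDerivAt (by simp) u w
  let P : Fin 4 → E4 →L[ℝ] ℝ := fun k => EuclideanSpace.proj k
  have hp : ∀ j k, HasFDerivAt (fun y => fderiv ℝ S y (stdVec j) k)
      ((P k) ∘L ((ContinuousLinearMap.apply ℝ E4 (stdVec j)) ∘L fderiv ℝ (fderiv ℝ S) x)) x :=
    fun j k => (P k).hasFDerivAt.comp x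
      ((ContinuousLinearMap.apply ℝ E4 (stdVec j)).hasFDerivAt.comp x hS')
  have hw : ∀ k, HasFDerivAt (fun y => W y k) ((P k) ∘L fderiv ℝ W x) x :=
    fun k => (P k).hasFDerivAt.comp x hW.hasFDerivAt
  have hY : ∀ i, fderiv ℝ (nullField S W i) x (stdVec i) =
      ∑ j, ((fderiv ℝ S x (stdVec j) j * fderiv ℝ W x (stdVec i) i
          + W x i * fderiv ℝ (fderiv ℝ S) x (stdVec i) (stdVec j) j)
        - (fderiv ℝ S x (stdVec j) i * fderiv ℝ W x (stdVec i) j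
          + W x j * fderiv ℝ (fderiv ℝ S) x (stdVec i) (stdVec j) i)) := by
    intro i
    have h := HasFDerivAt.fun_sum (u := Finset.univ) fun j _ =>
      ((hp j j).mul (hw i)).sub ((hp j i).mul (hw j))
    have h' := congrArg (fun L => L (stdVec i)) (HasFDerivAt.fderiv h)
    refine Eq.trans h' ?_
    simp [P]
  -- Swapping the summation indices and using the symmetry of the second derivative cancels all
  -- second-order terms.
  have hcancel : ∑ i, ∑ j, W x i * fderiv ℝ (fderiv ℝ S) x (stdVec i) (stdVec j) j =
      ∑ i, ∑ j, W x j * fderiv ℝ (fderiv ℝ S) x (stdVec i) (stdVec j) i := by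
    rw [Finset.sum_comm]
    exact Finset.sum_congr rfl fun i _ => Finset.sum_congr rfl fun j _ => by rw [hsymm]
  rw [polarSigma_eq_sum]
  simp only [hY, Finset.sum_sub_distrib, Finset.sum_add_distrib, hcancel]
  ring

/-- A null Lagrangian identity: no boundary contribution arises when `W` vanishes on the frontier
(away from the zeros of the radial weight) and the null field is tangent to the spheres. -/
theorem setIntegral_polarSigma_eq_zero {S W : E4 → E4} {Ω C : Set E4} {φ : ℝ → ℝ}
    (hΩ : IsOpen Ω) (hC : IsCompact C) (hCΩ : C ⊆ Ω) (hφ : ContDiff ℝ 1 φ)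
    (hS : ContDiffOn ℝ 2 S Ω) (hW : ContDiffOn ℝ 2 W Ω)
    (h0 : ∀ x ∈ frontier C, φ (‖x‖ ^ 2) = 0 ∨ W x = 0)
    (htan : ∀ x ∈ Ω, ∑ i, x i * nullField S W i x = 0) :
    ∫ x in C, φ (‖x‖ ^ 2) * polarSigma (fderiv ℝ S x) (fderiv ℝ W x) = 0 := by
  set f : Fin 4 → E4 → ℝ := fun i x => φ (‖x‖ ^ 2) * nullField S W i x with hf
  have hφ' : ContDiff ℝ 1 fun x : E4 => φ (‖x‖ ^ 2) := hφ.comp (contDiff_norm_sq ℝ)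
  have hfC : ∀ i, ContDiffOn ℝ 1 (f i) Ω := fun i =>
    hφ'.contDiffOn.mul (contDiffOn_nullField hΩ hS hW i)
  have hint : ∀ i, ∫ x in C, fderiv ℝ (f i) x (stdVec i) = 0 := fun i => by
    refine setIntegral_fderiv_eq_zero_of_frontier volume hΩ hC hCΩ (hfC i) (fun x hx => ?_) _
    rcases h0 x hx with h | h
    · simp [hf, h]
    · simp [hf, nullField_of_eq_zero h]
  have hI : ∀ i, IntegrableOn (fun x => fderiv ℝ (f i) x (stdVec i)) C := fun i =>
    ((((hfC i).continuousOn_fderiv_of_isOpen hΩ le_rfl).mono hCΩ).clm_apply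
      continuousOn_const).integrableOn_compact hC
  have hsum : ∫ x in C, ∑ i, fderiv ℝ (f i) x (stdVec i) = 0 := by
    rw [integral_finsetSum _ fun i _ => hI i]
    simp [hint]
  rw [← hsum]
  refine setIntegral_congr_fun hC.measurableSet fun x hx => ?_
  have hxΩ := hCΩ hx
  have hSx : ContDiffAt ℝ 2 S x := hS.contDiffAt (hΩ.mem_nhds hxΩ)
  have hWx : ContDiffAt ℝ 2 W x := hW.contDiffAt (hΩ.mem_nhds hxΩ)
  have hφx : HasFDerivAt (fun x : E4 => φ (‖x‖ ^ 2))
      (deriv φ (‖x‖ ^ 2) • ((2 : ℕ) • innerSL ℝ x)) x :=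
    (hφ.differentiable one_ne_zero _).hasDerivAt.comp_hasFDerivAt x
      (hasStrictFDerivAt_norm_sq x).hasFDerivAt
  -- The gradient of the weight is radial, so after summation over `i` its term is a multiple of the
  -- radial component, which `htan` annihilates.
  have hder : ∀ i, fderiv ℝ (f i) x (stdVec i) =
      φ (‖x‖ ^ 2) * fderiv ℝ (nullField S W i) x (stdVec i)
        + 2 * deriv φ (‖x‖ ^ 2) * (x i * nullField S W i x) := fun i => by
    have hn := (((contDiffOn_nullField hΩ hS hW i).contDiffAt
      (hΩ.mem_nhds hxΩ)).differentiableAt one_ne_zero).hasFDerivAt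
    have := congrArg (fun L => L (stdVec i)) (hφx.mul hn).fderiv
    refine Eq.trans this ?_
    simp [EuclideanSpace.inner_single_right]
    ring
  simp only [hder, Finset.sum_add_distrib, ← Finset.mul_sum, htan x hxΩ, mul_zero, add_zero]
  rw [sum_fderiv_nullField hSx (hWx.differentiableAt (by norm_num))]

/-! ### Polar coordinates and integration over shells. -/

instance isFiniteMeasure_volS3 : IsFiniteMeasure volS3 := by
  unfold volS3
  infer_instance

/-- Integration in polar coordinates of a product of a radial and an angular function. -/
theorem integral_radial_mul_angular (a : ℝ → ℝ) (b : S3 → ℝ) :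
    ∫ x : E4, a ‖x‖ * b (radialProj x) =
      (∫ y, b y ∂volS3) * ∫ r : Ioi (0 : ℝ), a r ∂(Measure.volumeIoiPow 3) := by
  have hdim : Module.finrank ℝ E4 - 1 = 3 := by simp
  have hmp := (volume : Measure E4).measurePreserving_homeomorphUnitSphereProd
  rw [hdim] at hmp
  have h1 : ∫ x : E4, a ‖x‖ * b (radialProj x) =
      ∫ x in ({0}ᶜ : Set E4), a ‖x‖ * b (radialProj x) := by
    rw [Measure.restrict_eq_self_of_ae_mem]
    simp [ae_iff]
  rw [h1, ← integral_subtype_comap (measurableSet_singleton (0 : E4)).compl,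
    ← integral_prod_mul, volS3,
    ← hmp.integral_comp (homeomorphUnitSphereProd E4).measurableEmbedding]
  refine integral_congr_ae (Filter.Eventually.of_forall fun x => ?_)
  have hx : (homeomorphUnitSphereProd E4 x).1 = radialProj x := by
    ext1
    rw [coe_radialProj x.2]
    simp
  simp only [hx, homeomorphUnitSphereProd_apply_snd_coe]
  ring

/-- The part of the cone over `K` between the spheres of radii `1` and `2`. -/
def shell (K : Set S3) : Set E4 := {x | ‖x‖ ∈ Icc (1 : ℝ) 2 ∧ radialProj x ∈ K}

theorem shell_ne_zero {K : Set S3} {x : E4} (hx : x ∈ shell K) : x ≠ 0 := by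
  rintro rfl
  have := hx.1.1
  simp at this
  linarith

theorem isCompact_shell {K : Set S3} (hK : IsCompact K) : IsCompact (shell K) := by
  have h : shell K = (fun p : ℝ × S3 => p.1 • (p.2 : E4)) '' (Icc (1 : ℝ) 2 ×ˢ K) := by
    ext x
    constructor
    · exact fun hx => ⟨(‖x‖, radialProj x), ⟨hx.1, hx.2⟩, norm_smul_radialProj x⟩
    · rintro ⟨⟨r, y⟩, ⟨hr, hy⟩, rfl⟩
      have hr0 : 0 < r := lt_of_lt_of_le one_pos hr.1
      refine ⟨?_, ?_⟩
      · simpa [norm_smul, norm_S3, abs_of_pos hr0] using hr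
      · rw [radialProj_smul hr0, radialProj_coe]
        exact hy
  rw [h]
  exact (isCompact_Icc.prod hK).image (by fun_prop)

theorem shell_subset_coneOver {K U : Set S3} (hKU : K ⊆ U) : shell K ⊆ coneOver U :=
  fun _ hx => ⟨shell_ne_zero hx, hKU hx.2⟩

theorem frontier_shell {K : Set S3} (hK : IsCompact K) {x : E4} (hx : x ∈ frontier (shell K)) :
    x ∈ shell K ∧ (‖x‖ = 1 ∨ ‖x‖ = 2 ∨ radialProj x ∈ frontier K) := by
  have hxs : x ∈ shell K := (isCompact_shell hK).isClosed.frontier_subset hx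
  refine ⟨hxs, ?_⟩
  by_contra hcon
  simp only [not_or] at hcon
  obtain ⟨h1, h2, h3⟩ := hcon
  have hi : radialProj x ∈ interior K := by
    by_contra hi
    exact h3 ⟨subset_closure hxs.2, hi⟩
  refine hx.2 (mem_interior_iff_mem_nhds.2 ?_)
  have hn : ‖x‖ ∈ Ioo (1 : ℝ) 2 := ⟨lt_of_le_of_ne hxs.1.1 (Ne.symm h1), lt_of_le_of_ne hxs.1.2 h2⟩
  filter_upwards [(continuousAt_radialProj (shell_ne_zero hxs)).preimage_mem_nhds
    (isOpen_interior.mem_nhds hi), continuous_norm.continuousAt.preimage_mem_nhds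
    (isOpen_Ioo.mem_nhds hn)] with y hy1 hy2
  exact ⟨Ioo_subset_Icc_self hy2, interior_subset hy1⟩

/-- A radial weight that is positive between the spheres of radii `1` and `2` and vanishes on
them, as a function of the square of the radius. -/
def shellWeight (t : ℝ) : ℝ := (t - 1) * (4 - t)

theorem contDiff_shellWeight : ContDiff ℝ 1 shellWeight := by
  unfold shellWeight
  fun_prop

/-- A weighted integral over a shell is a nonzero multiple of an integral over the sphere. -/
theorem exists_setIntegral_shell : ∃ c : ℝ, c ≠ 0 ∧ ∀ (K : Set S3), IsCompact K → ∀ g : S3 → ℝ,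
    ∫ x in shell K, shellWeight (‖x‖ ^ 2) * ((‖x‖ ^ 2)⁻¹ * g (radialProj x)) =
      (∫ y in K, g y ∂volS3) * c := by
  set a : ℝ → ℝ := (Icc (1 : ℝ) 2).indicator fun r => shellWeight (r ^ 2) * (r ^ 2)⁻¹ with ha
  have key : ∀ (K : Set S3), IsCompact K → ∀ g : S3 → ℝ,
      ∫ x in shell K, shellWeight (‖x‖ ^ 2) * ((‖x‖ ^ 2)⁻¹ * g (radialProj x)) =
        (∫ y in K, g y ∂volS3) * ∫ r : Ioi (0 : ℝ), a r ∂(Measure.volumeIoiPow 3) := by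
    intro K hK g
    rw [← integral_indicator hK.measurableSet, ← integral_radial_mul_angular,
      ← integral_indicator (isCompact_shell hK).measurableSet]
    refine integral_congr_ae (Filter.Eventually.of_forall fun x => ?_)
    by_cases h1 : ‖x‖ ∈ Icc (1 : ℝ) 2
    · by_cases h2 : radialProj x ∈ K
      · have : x ∈ shell K := ⟨h1, h2⟩
        simp only [ha, indicator_of_mem h1, indicator_of_mem h2, indicator_of_mem this]
        ring
      · have : x ∉ shell K := fun h => h2 h.2
        simp [indicator_of_notMem h2, indicator_of_notMem this]
    · have : x ∉ shell K := fun h => h1 h.1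
      simp [ha, indicator_of_notMem h1, indicator_of_notMem this]
  refine ⟨_, fun hc => ?_, key⟩
  -- The radial constant is nonzero: testing with the full shell and `g = 1` gives the integral of a
  -- function positive for `1 < ‖x‖ < 2`.
  have h0 := key univ isCompact_univ fun _ => 1
  rw [hc, mul_zero] at h0
  have hs := isCompact_shell (isCompact_univ (X := S3))
  have hpos : ∀ x ∈ shell univ, 0 ≤ shellWeight (‖x‖ ^ 2) * ((‖x‖ ^ 2)⁻¹ * 1) := by
    intro x hx
    have h1 := hx.1.1
    have h2 := hx.1.2
    have : 0 ≤ shellWeight (‖x‖ ^ 2) := mul_nonneg (by nlinarith) (by nlinarith)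
    positivity
  have hcont : ContinuousOn (fun x : E4 => shellWeight (‖x‖ ^ 2) * ((‖x‖ ^ 2)⁻¹ * 1))
      (shell univ) := by
    have h1 : Continuous fun x : E4 => shellWeight (‖x‖ ^ 2) :=
      contDiff_shellWeight.continuous.comp (by fun_prop)
    refine h1.continuousOn.mul (ContinuousOn.mul (ContinuousOn.inv₀ (by fun_prop) ?_)
      continuousOn_const)
    intro x hx
    exact pow_ne_zero 2 (norm_ne_zero_iff.2 (shell_ne_zero hx))
  have hlt := (setIntegral_pos_iff_support_of_nonneg_ae
    ((ae_restrict_iff' hs.measurableSet).2 (Filter.Eventually.of_forall hpos))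
    (hcont.integrableOn_compact (μ := volume) hs)).2
  refine absurd (hlt ?_) (by rw [h0]; exact lt_irrefl _)
  have hopen : IsOpen {x : E4 | ‖x‖ ∈ Ioo (1 : ℝ) 2} := isOpen_Ioo.preimage continuous_norm
  have hne : {x : E4 | ‖x‖ ∈ Ioo (1 : ℝ) 2}.Nonempty :=
    ⟨EuclideanSpace.single 0 (3 / 2), by
      simp only [mem_ofPred_eq, PiLp.norm_single]
      norm_num⟩
  refine (hopen.measure_pos volume hne).trans_le (measure_mono fun x hx => ?_)
  have h1 : 1 < ‖x‖ := hx.1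
  have h2 : ‖x‖ < 2 := hx.2
  refine ⟨?_, ⟨h1.le, h2.le⟩, mem_univ _⟩
  have : 0 < shellWeight (‖x‖ ^ 2) := mul_pos (by nlinarith) (by nlinarith)
  have h3 : 0 < ‖x‖ := by linarith
  exact (by positivity : 0 < shellWeight (‖x‖ ^ 2) * ((‖x‖ ^ 2)⁻¹ * 1)).ne'

/-! ### Pointwise matrix inequalities. -/

/-- Twice the second elementary symmetric function of a `3 × 3` matrix. -/
noncomputable def Matrix.twoSigma (M : Matrix (Fin 3) (Fin 3) ℝ) : ℝ :=
  M.trace ^ 2 - (M * M).trace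

open Matrix in
theorem Matrix.exists_orthogonal_col (n : Fin 3 → ℝ) (hn : n ⬝ᵥ n = 1) :
    ∃ Q : Matrix (Fin 3) (Fin 3) ℝ, Qᵀ * Q = 1 ∧ ∀ i, Q i 2 = n i := by
  have ho : Orthonormal ℝ (({2} : Set (Fin 3)).domRestrict
      fun _ => (WithLp.toLp 2 n : EuclideanSpace ℝ (Fin 3))) := by
    rw [orthonormal_iff_ite]
    rintro ⟨i, hi⟩ ⟨j, hj⟩
    obtain rfl : i = 2 := hi
    obtain rfl : j = 2 := hj
    change inner ℝ (WithLp.toLp 2 n) (WithLp.toLp 2 n) = _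
    rw [if_pos rfl, PiLp.inner_apply, ← hn]
    exact Finset.sum_congr rfl fun k _ => by simp [sq]
  obtain ⟨b, hb⟩ := ho.exists_orthonormalBasis_extension_of_card_eq (by simp)
  refine ⟨Matrix.of fun i j => b j i, ?_, fun i => ?_⟩
  · ext i j
    have := orthonormal_iff_ite.1 b.orthonormal i j
    rw [PiLp.inner_apply] at this
    simp only [Matrix.mul_apply, transpose_apply, of_apply, one_apply]
    rw [← this]
    exact Finset.sum_congr rfl fun k _ => by simp [mul_comm]
  · simp [hb 2 rfl]

-- Rotate `n` to the last basis vector: the last row then vanishes, `twoSigma` is twice the upper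
-- left `2 × 2` minor, and both differences are sums of squares.
open Matrix in
theorem Matrix.twoSigma_bounds {M : Matrix (Fin 3) (Fin 3) ℝ} {n : Fin 3 → ℝ} (hn : n ⬝ᵥ n = 1)
    (hM : n ᵥ* M = 0) :
    (1 + M.twoSigma / 2) ^ 2 ≤ (1 + Mᵀ * M).det ∧ M.twoSigma ≤ (Mᵀ * M).trace := by
  obtain ⟨Q, hQ, hQn⟩ := exists_orthogonal_col n hn
  have hQ' : Q * Qᵀ = 1 := mul_eq_one_comm.1 hQ
  set N := Qᵀ * M * Q with hN
  have hNN : N * N = Qᵀ * (M * M) * Q := by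
    calc N * N = Qᵀ * M * (Q * Qᵀ) * M * Q := by simp only [hN, Matrix.mul_assoc]
      _ = _ := by rw [hQ']; simp only [Matrix.mul_assoc, Matrix.one_mul]
  have hNT : Nᵀ * N = Qᵀ * (Mᵀ * M) * Q := by
    calc Nᵀ * N = Qᵀ * Mᵀ * (Q * Qᵀ) * M * Q := by
          simp only [hN, transpose_mul, transpose_transpose, Matrix.mul_assoc]
      _ = _ := by rw [hQ']; simp only [Matrix.mul_assoc, Matrix.one_mul]
  have htr : ∀ A : Matrix (Fin 3) (Fin 3) ℝ, (Qᵀ * A * Q).trace = A.trace := fun A => by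
    rw [trace_mul_cycle, hQ', Matrix.one_mul]
  have hdet : (1 + Nᵀ * N).det = (1 + Mᵀ * M).det := by
    have : 1 + Nᵀ * N = Qᵀ * (1 + Mᵀ * M) * Q := by
      rw [hNT, Matrix.mul_add, Matrix.add_mul, Matrix.mul_one, hQ]
    rw [this, det_mul, det_mul, mul_right_comm, ← det_mul, hQ, det_one, one_mul]
  have hs : N.twoSigma = M.twoSigma := by rw [twoSigma, twoSigma, hNN, htr, htr]
  have hrow : ∀ j, N 2 j = 0 := by
    intro j
    have h1 : ∀ k, (Qᵀ * M) 2 k = 0 := fun k => by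
      have := congrFun hM k
      simpa [mul_apply, vecMul, dotProduct, hQn] using this
    rw [hN, mul_apply]
    simp [h1]
  rw [← hs, ← hdet, ← htr (Mᵀ * M), ← hNT]
  have e1 : N.twoSigma = 2 * (N 0 0 * N 1 1 - N 0 1 * N 1 0) := by
    simp only [twoSigma, trace_fin_three, mul_apply, Fin.sum_univ_three, hrow]
    ring
  have e2 : (Nᵀ * N).trace = N 0 0 ^ 2 + N 0 1 ^ 2 + N 0 2 ^ 2 + N 1 0 ^ 2 + N 1 1 ^ 2
      + N 1 2 ^ 2 := by
    simp only [trace_fin_three, mul_apply, transpose_apply, Fin.sum_univ_three, hrow]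
    ring
  -- By Cauchy–Binet the determinant is `1` plus the squares of all entries and of all `2 × 2`
  -- minors; the square is completed with the upper left minor.
  have e3 : (1 + Nᵀ * N).det = (1 + (N 0 0 * N 1 1 - N 0 1 * N 1 0)) ^ 2
      + (N 0 0 - N 1 1) ^ 2 + (N 0 1 + N 1 0) ^ 2 + N 0 2 ^ 2 + N 1 2 ^ 2
      + (N 0 0 * N 1 2 - N 0 2 * N 1 0) ^ 2 + (N 0 1 * N 1 2 - N 0 2 * N 1 1) ^ 2 := by
    simp [det_fin_three, mul_apply, transpose_apply, Fin.sum_univ_three, hrow]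
    ring
  rw [e1, e2, e3, mul_div_cancel_left₀ _ two_ne_zero]
  constructor
  · nlinarith [sq_nonneg (N 0 0 - N 1 1), sq_nonneg (N 0 1 + N 1 0), sq_nonneg (N 0 2),
      sq_nonneg (N 1 2), sq_nonneg (N 0 0 * N 1 2 - N 0 2 * N 1 0),
      sq_nonneg (N 0 1 * N 1 2 - N 0 2 * N 1 1)]
  · nlinarith [sq_nonneg (N 0 0 - N 1 1), sq_nonneg (N 0 1 + N 1 0), sq_nonneg (N 0 2),
      sq_nonneg (N 1 2)]

-- The eigenvalues are `2, 2, 1`.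
open Matrix in
theorem Matrix.det_two_sub_vecMulVec {n : Fin 3 → ℝ} (hn : n ⬝ᵥ n = 1) :
    (1 + (1 - vecMulVec n n)).det = 4 := by
  have h : n 0 * n 0 + n 1 * n 1 + n 2 * n 2 = 1 := by
    simpa [dotProduct, Fin.sum_univ_three] using hn
  simp [det_fin_three, vecMulVec_apply]
  linear_combination (-4) * h

/-! ### Volume and energy densities in an orthonormal frame. -/

theorem inner_frame (x : S3) (i : Fin 3) : inner ℝ (x : E4) (frame x i : E4) = 0 :=
  (frame x i).2 _ (Submodule.mem_span_singleton_self _)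

theorem inner_frame_frame (x : S3) (i j : Fin 3) :
    inner ℝ (frame x i : E4) (frame x j : E4) = if i = j then (1 : ℝ) else 0 :=
  orthonormal_iff_ite.1 (frame x).orthonormal i j

/-- A point of the sphere followed by the orthonormal frame at that point. -/
theorem exists_orthonormalBasis_cons_frame (x : S3) :
    ∃ b : OrthonormalBasis (Fin 4) ℝ E4, b 0 = x ∧ ∀ i : Fin 3, b i.succ = frame x i := by
  set w : Fin 4 → E4 := Fin.cons (x : E4) fun i => (frame x i : E4) with hw
  have ho : Orthonormal ℝ w := by
    rw [orthonormal_iff_ite]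
    intro i j
    refine Fin.cases ?_ (fun i => ?_) i <;> refine Fin.cases ?_ (fun j => ?_) j
    · simp [hw]
    · simpa [hw, (Fin.succ_ne_zero j).symm] using inner_frame x j
    · simpa [hw, Fin.succ_ne_zero i, real_inner_comm] using inner_frame x i
    · simpa [hw] using inner_frame_frame x i j
  obtain ⟨b, hb⟩ := Orthonormal.exists_orthonormalBasis_extension_of_card_eq (𝕜 := ℝ)
    (ι := Fin 4) (s := univ) (v := w) (by simp) (ho.comp _ Subtype.val_injective)
  exact ⟨b, hb 0 (mem_univ _), fun i => hb i.succ (mem_univ _)⟩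

section

variable {v : S3 → E4} {U : Set S3}

/-- The matrix of the covariant derivative of `v` at `x` in the orthonormal frame. -/
noncomputable def covMatrix (v : S3 → E4) (x : S3) : Matrix (Fin 3) (Fin 3) ℝ :=
  Matrix.of fun k i => inner ℝ (frame x k : E4) (sphereDeriv v x (frame x i))

theorem inner_eq_sum_frame (x : S3) (a b : E4) :
    inner ℝ a b = inner ℝ a (x : E4) * inner ℝ (x : E4) b +
      ∑ k, inner ℝ a (frame x k : E4) * inner ℝ (frame x k : E4) b := by
  obtain ⟨e, he0, he⟩ := exists_orthonormalBasis_cons_frame x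
  rw [← e.sum_inner_mul_inner, Fin.sum_univ_succ]
  simp only [he0, he]

theorem inner_frame_tanProj (x : S3) (k : Fin 3) (a : E4) :
    inner ℝ (frame x k : E4) (tanProj x a) = inner ℝ (frame x k : E4) a := by
  rw [tanProj, inner_sub_right, real_inner_smul_right,
    real_inner_comm (x : E4) (frame x k : E4), inner_frame, mul_zero, sub_zero]

theorem inner_self_tanProj (x : S3) (a : E4) : inner ℝ (x : E4) (tanProj x a) = 0 := by
  rw [tanProj, inner_sub_right, real_inner_smul_right, real_inner_self_eq_norm_sq, norm_S3]
  ring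

theorem inner_tanProj_tanProj (x : S3) (a b : E4) :
    inner ℝ (tanProj x a) (tanProj x b) =
      ∑ k, inner ℝ (frame x k : E4) a * inner ℝ (frame x k : E4) b := by
  rw [inner_eq_sum_frame x, inner_self_tanProj, mul_zero, zero_add]
  exact Finset.sum_congr rfl fun k _ => by
    rw [real_inner_comm, inner_frame_tanProj, inner_frame_tanProj]

theorem IsUnitVectorFieldOn.sasakiGram_eq (hv : IsUnitVectorFieldOn v U) (hU : IsOpen U) {x : S3}
    (hx : x ∈ U) : sasakiGram v x = 1 + (covMatrix v x).transpose * covMatrix v x := by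
  have hd := hv.differentiableAt hU (coe_mem_coneOver hx)
  ext i j
  simp only [sasakiGram, Matrix.of_apply, sasaki, sphereDeriv_sectionMap hd, sectionMap,
    Matrix.add_apply, Matrix.mul_apply, Matrix.transpose_apply, covMatrix, Matrix.one_apply,
    inner_frame_frame, inner_tanProj_tanProj, sphereDeriv_eq_fderiv_radialExt hd]

theorem normSqCovDeriv_eq (v : S3 → E4) (x : S3) :
    normSqCovDeriv v x = ((covMatrix v x).transpose * covMatrix v x).trace := by
  simp only [normSqCovDeriv, covDeriv, ← real_inner_self_eq_norm_sq, inner_tanProj_tanProj,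
    Matrix.trace, Matrix.diag_apply, Matrix.mul_apply, Matrix.transpose_apply, covMatrix,
    Matrix.of_apply]

/-- Twice the second elementary symmetric function of `∇v`, computed in the ambient space. -/
noncomputable def sigmaField (v : S3 → E4) (x : E4) : ℝ :=
  polarSigma (fderiv ℝ (radialExt v) x) (fderiv ℝ (radialExt v) x)

/-- The derivative of the radial extension kills `x`, so in the basis `x, e₁, e₂, e₃` its first
column is zero and the traces of it and of its square only see the tangential block. -/
theorem IsUnitVectorFieldOn.sigmaField_eq (hv : IsUnitVectorFieldOn v U) (hU : IsOpen U) {x : S3}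
    (hx : x ∈ U) : sigmaField v x = (covMatrix v x).twoSigma := by
  have hd := hv.differentiableAt hU (coe_mem_coneOver hx)
  obtain ⟨e, he0, he⟩ := exists_orthonormalBasis_cons_frame x
  set A := fderiv ℝ (radialExt v) x with hA
  have hAx : A x = 0 := fderiv_radialExt_self v hd
  have hM : ∀ k i, covMatrix v x k i = inner ℝ (frame x k : E4) (A (frame x i)) := fun k i => by
    rw [covMatrix, Matrix.of_apply, sphereDeriv_eq_fderiv_radialExt hd]
  have hAA : ∀ k, A (A (frame x k)) = ∑ l, covMatrix v x l k • A (frame x l) := by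
    intro k
    conv_lhs => rw [← e.sum_repr' (A (frame x k))]
    simp only [map_add, map_sum, map_smul, Fin.sum_univ_succ (n := 3), he0, he, hAx, smul_zero, zero_add,
      hM]
  have h1 : LinearMap.trace ℝ E4 A = (covMatrix v x).trace := by
    rw [LinearMap.trace_eq_sum_inner _ e, Fin.sum_univ_succ]
    simp [he0, he, hAx, Matrix.trace, hM]
  have h2 : LinearMap.trace ℝ E4 (A ∘L A : E4 →L[ℝ] E4) = (covMatrix v x * covMatrix v x).trace := by
    rw [LinearMap.trace_eq_sum_inner _ e, Fin.sum_univ_succ]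
    simp only [he0, he, ContinuousLinearMap.coe_coe, ContinuousLinearMap.comp_apply, hAx, map_zero,
      inner_zero_right, zero_add, hAA, inner_sum, real_inner_smul_right, Matrix.trace,
      Matrix.diag_apply, Matrix.mul_apply, ← hM]
    exact Finset.sum_congr rfl fun k _ => Finset.sum_congr rfl fun l _ => mul_comm _ _
  rw [sigmaField, polarSigma, h1, h2, Matrix.twoSigma, sq]

theorem sum_inner_frame_mul_self {x : S3} {a : E4} (ha : inner ℝ (x : E4) a = 0) (hn : ‖a‖ = 1) :
    (fun k => inner ℝ (frame x k : E4) a) ⬝ᵥ (fun k => inner ℝ (frame x k : E4) a) = (1 : ℝ) := by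
  have h := inner_eq_sum_frame x a a
  rw [real_inner_self_eq_norm_sq, hn, ha, mul_zero, zero_add, one_pow] at h
  rw [h]
  exact Finset.sum_congr rfl fun k _ => by rw [real_inner_comm]

/-- The pointwise lower bounds for the volume and energy densities. -/
theorem IsUnitVectorFieldOn.density_bounds (hv : IsUnitVectorFieldOn v U) (hU : IsOpen U) {x : S3}
    (hx : x ∈ U) : 1 + sigmaField v x / 2 ≤ Real.sqrt (sasakiGram v x).det ∧
      sigmaField v x ≤ normSqCovDeriv v x := by
  have hd := hv.differentiableAt hU (coe_mem_coneOver hx)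
  have hvx : radialExt v x = v x := by rw [radialExt, radialProj_coe]
  have hM : Matrix.vecMul (fun k => inner ℝ (frame x k : E4) (v x)) (covMatrix v x) = 0 := by
    ext i
    have h := hv.inner_fderiv hU (coe_mem_coneOver hx) (frame x i : E4)
    rw [hvx, inner_eq_sum_frame x, real_inner_comm, hv.tangent x hx, zero_mul, zero_add,
      ← sphereDeriv_eq_fderiv_radialExt hd] at h
    change ∑ k, inner ℝ (frame x k : E4) (v x) * covMatrix v x k i = 0
    rw [← h]
    refine Finset.sum_congr rfl fun k _ => ?_
    rw [covMatrix, Matrix.of_apply, real_inner_comm]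
  have hb := Matrix.twoSigma_bounds
    (sum_inner_frame_mul_self (hv.tangent x hx) (hv.unit x hx)) hM
  rw [hv.sigmaField_eq hU hx, hv.sasakiGram_eq hU hx, normSqCovDeriv_eq]
  exact ⟨Real.le_sqrt_of_sq_le hb.1, hb.2⟩

end

/-! ### Hopf fields attain the bounds. -/

section

variable {H : S3 → E4}

theorem inner_map_self_of_sq_eq_neg {J : E4 →ₗᵢ[ℝ] E4} (hJ : ∀ y, J (J y) = -y) (a b : E4) :
    inner ℝ a (J b) = - inner ℝ (J a) b := by
  rw [← J.inner_map_map a (J b), hJ, inner_neg_right]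

theorem IsHopfField.isUnitVectorFieldOn (hH : IsHopfField H) : IsUnitVectorFieldOn H univ := by
  obtain ⟨J, hJ, hHJ⟩ := hH
  obtain rfl : H = fun x : S3 => J x := funext hHJ
  refine ⟨?_, fun x _ => ?_, fun x _ => ?_⟩
  · exact (J.toContinuousLinearMap.contDiff.contMDiff.comp
      (contMDiff_coe_sphere (n := 3))).contMDiffOn
  · have h := inner_map_self_of_sq_eq_neg hJ (x : E4) x
    rw [real_inner_comm (x : E4) (J x)] at h
    linarith [real_inner_comm (x : E4) (J x)]
  · rw [J.norm_map, norm_S3]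

/-- The densities of a Hopf vector field are constant. -/
theorem IsHopfField.density (hH : IsHopfField H) (x : S3) :
    Real.sqrt (sasakiGram H x).det = 2 ∧ normSqCovDeriv H x = 2 ∧ sigmaField H x = 2 := by
  have hv := hH.isUnitVectorFieldOn
  obtain ⟨J, hJ, hHJ⟩ := hH
  set M := covMatrix H x with hMdef
  set n : Fin 3 → ℝ := fun k => inner ℝ (frame x k : E4) (H x) with hn
  have hnn : n ⬝ᵥ n = 1 := sum_inner_frame_mul_self (hv.tangent x (mem_univ x)) (hv.unit x (mem_univ x))
  have hM : ∀ k i, M k i = inner ℝ (frame x k : E4) (J (frame x i)) := fun k i => by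
    rw [hMdef, covMatrix, Matrix.of_apply, sphereDeriv_eq_fderiv (G := J)
      J.toContinuousLinearMap.differentiableAt hHJ]
    exact congrArg (fun L : E4 →L[ℝ] E4 => inner ℝ (frame x k : E4) (L (frame x i)))
      J.toContinuousLinearMap.fderiv
  have hanti : M.transpose = -M := by
    ext i j
    rw [Matrix.transpose_apply, Matrix.neg_apply, hM, hM, inner_map_self_of_sq_eq_neg hJ,
      real_inner_comm]
  -- `M` is the compression of the isometry `J` to `x^⊥`; what is lost is the component of `J eᵢ`
  -- along `x`, namely `-⟨eᵢ, J x⟩`.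
  have hMM : M.transpose * M = 1 - Matrix.vecMulVec n n := by
    ext i j
    have h := inner_eq_sum_frame x (J (frame x i)) (J (frame x j))
    rw [J.inner_map_map, inner_frame_frame, inner_map_self_of_sq_eq_neg hJ (x : E4), ← hHJ,
      real_inner_comm (x : E4), inner_map_self_of_sq_eq_neg hJ (x : E4), ← hHJ] at h
    rw [Matrix.sub_apply, Matrix.one_apply, h, Matrix.mul_apply, Matrix.vecMulVec_apply]
    simp only [Matrix.transpose_apply, hM, hn]
    rw [real_inner_comm (H x) (frame x i : E4), real_inner_comm (H x) (frame x j : E4)]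
    simp only [real_inner_comm (frame x _ : E4) (J (frame x i))]
    ring
  have htr : (M.transpose * M).trace = 2 := by
    rw [hMM, Matrix.trace_sub, Matrix.trace_one, Matrix.trace_vecMulVec, hnn]
    norm_num
  have htr0 : M.trace = 0 := by
    have := Matrix.trace_transpose M
    rw [hanti, Matrix.trace_neg] at this
    linarith
  refine ⟨?_, ?_, ?_⟩
  · rw [hv.sasakiGram_eq isOpen_univ (mem_univ x), ← hMdef, hMM, Matrix.det_two_sub_vecMulVec hnn,
      show (4 : ℝ) = 2 ^ 2 by norm_num, Real.sqrt_sq zero_le_two]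
  · rw [normSqCovDeriv_eq, ← hMdef, htr]
  · rw [hv.sigmaField_eq isOpen_univ (mem_univ x), ← hMdef, Matrix.twoSigma, htr0]
    rw [hanti, Matrix.neg_mul, Matrix.trace_neg] at htr
    rw [sub_eq_add_neg, htr]
    norm_num

end

/-! ### Invariance of the integral of `σ`, and the conclusion. -/

section

variable {v w : S3 → E4} {U K : Set S3}

theorem continuousOn_sigmaField (hU : IsOpen U) (hv : IsUnitVectorFieldOn v U) :
    ContinuousOn (fun x : S3 => sigmaField v x) U := by
  have hc : ContinuousOn (fderiv ℝ (radialExt v)) (coneOver U) :=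
    (contDiffOn_radialExt hU hv.smooth).continuousOn_fderiv_of_isOpen (isOpen_coneOver hU)
      (by simp)
  have hc' : ContinuousOn (fun x : S3 => fderiv ℝ (radialExt v) x) U :=
    hc.comp continuous_subtype_val.continuousOn fun x hx => coe_mem_coneOver hx
  have he : ∀ i j, ContinuousOn (fun x : S3 => fderiv ℝ (radialExt v) x (stdVec i) j) U :=
    fun i j => (EuclideanSpace.proj (𝕜 := ℝ) j).continuous.comp_continuousOn
      (hc'.clm_apply continuousOn_const)
  simp only [sigmaField, polarSigma_eq_sum]
  exact continuousOn_finsetSum _ fun i _ => continuousOn_finsetSum _ fun j _ =>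
    ((he j j).mul (he i i)).sub ((he j i).mul (he i j))

theorem polarSigma_smul_smul (c : ℝ) (A B : E4 →L[ℝ] E4) :
    polarSigma (c • A) (c • B) = c ^ 2 * polarSigma A B := by
  simp only [polarSigma_eq_sum, Finset.mul_sum]
  refine Finset.sum_congr rfl fun i _ => Finset.sum_congr rfl fun j _ => ?_
  simp only [smul_apply, PiLp.smul_apply, smul_eq_mul]
  ring

theorem sigmaField_eq_radialProj (v : S3 → E4) {x : E4} (hx : x ≠ 0) :
    sigmaField v x = (‖x‖ ^ 2)⁻¹ * sigmaField v (radialProj x) := by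
  have h := fderiv_radialExt_smul v (norm_pos_iff.2 hx) (radialProj x)
  rw [norm_smul_radialProj] at h
  rw [sigmaField, h, polarSigma_smul_smul, inv_pow, sigmaField]

/-- Since `W` is orthogonal to `x`, the radial component reduces to `⟨v - w, v + w⟩ = |v|² - |w|²`,
which is zero for unit fields. -/
theorem IsUnitVectorFieldOn.sum_mul_nullField_eq_zero (hU : IsOpen U)
    (hv : IsUnitVectorFieldOn v U) (hw : IsUnitVectorFieldOn w U) {x : E4} (hx : x ∈ coneOver U) :
    ∑ i, x i * nullField (radialExt v + radialExt w) (radialExt v - radialExt w) i x = 0 := by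
  have hS : DifferentiableAt ℝ (radialExt v + radialExt w) x :=
    (hv.differentiableAt hU hx).add (hw.differentiableAt hU hx)
  rw [sum_mul_nullField, inner_fderiv_of_orthogonal (isOpen_coneOver hU) (fun y hy => by
    rw [Pi.add_apply, inner_add_right, hv.inner_radialExt hy, hw.inner_radialExt hy, add_zero])
    hx hS]
  simp only [Pi.add_apply, Pi.sub_apply, inner_sub_right, inner_sub_left, inner_add_right,
    hv.inner_radialExt hx, hw.inner_radialExt hx, real_inner_self_eq_norm_sq,
    hv.norm_radialExt hx, hw.norm_radialExt hx]
  rw [real_inner_comm]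
  ring

/-- The integral of the second elementary symmetric function of `∇v` over a compact set only
depends on the values of `v` on the frontier. -/
theorem setIntegral_sigmaField_eq (hU : IsOpen U) (hK : IsCompact K) (hKU : K ⊆ U)
    (hv : IsUnitVectorFieldOn v U) (hw : IsUnitVectorFieldOn w U)
    (hvw : ∀ x ∈ frontier K, v x = w x) :
    ∫ x in K, sigmaField v x ∂volS3 = ∫ x in K, sigmaField w x ∂volS3 := by
  have hV : ContDiffOn ℝ 2 (radialExt v) (coneOver U) :=
    (contDiffOn_radialExt hU hv.smooth).of_le (WithTop.coe_le_coe.2 (le_top : (2 : ℕ∞) ≤ ⊤))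
  have hW : ContDiffOn ℝ 2 (radialExt w) (coneOver U) :=
    (contDiffOn_radialExt hU hw.smooth).of_le (WithTop.coe_le_coe.2 (le_top : (2 : ℕ∞) ≤ ⊤))
  have h := setIntegral_polarSigma_eq_zero (isOpen_coneOver hU) (isCompact_shell hK)
    -- The weight handles the two spherical ends of the shell, and `v = w` handles the lateral part
    -- over `∂K`.
    (shell_subset_coneOver hKU) contDiff_shellWeight (hV.add hW) (hV.sub hW) (fun x hx => by
      obtain ⟨-, h1 | h1 | h1⟩ := frontier_shell hK hx
      · left; simp [shellWeight, h1]
      · left; rw [shellWeight, h1]; norm_num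
      · right; simp [radialExt, hvw _ h1])
    (fun x hx => hv.sum_mul_nullField_eq_zero hU hw hx)
  obtain ⟨c, hc, hpolar⟩ := exists_setIntegral_shell
  have h2 := hpolar K hK fun x => sigmaField v x - sigmaField w x
  rw [← sub_eq_zero, ← integral_sub
    (((continuousOn_sigmaField hU hv).mono hKU).integrableOn_compact hK)
    (((continuousOn_sigmaField hU hw).mono hKU).integrableOn_compact hK)]
  refine (mul_eq_zero.1 (h2.symm.trans (Eq.trans ?_ h))).resolve_right hc
  refine setIntegral_congr_fun (isCompact_shell hK).measurableSet fun x hx => ?_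
  have hxU := shell_subset_coneOver hKU hx
  have hdv := hv.differentiableAt hU hxU
  have hdw := hw.differentiableAt hU hxU
  rw [fderiv_fun_add hdv hdw, fderiv_fun_sub hdv hdw, polarSigma_add_sub]
  change _ = _ * (sigmaField v x - sigmaField w x)
  rw [sigmaField_eq_radialProj v hxU.1, sigmaField_eq_radialProj w hxU.1, ← mul_sub]

end

/-- The lower bound `f` may be negative, so the comparison passes through its positive part; nothing
is required of `g` beyond the inequality. -/
theorem ofReal_setIntegral_le_setLIntegral {α : Type*} [MeasurableSpace α] {μ : Measure α}
    {s : Set α} (hs : MeasurableSet s) {f g : α → ℝ} (hf : IntegrableOn f s μ)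
    (hfg : ∀ x ∈ s, f x ≤ g x) :
    ENNReal.ofReal (∫ x in s, f x ∂μ) ≤ ∫⁻ x in s, ENNReal.ofReal (g x) ∂μ := by
  calc ENNReal.ofReal (∫ x in s, f x ∂μ)
      ≤ ENNReal.ofReal (∫ x in s, max (f x) 0 ∂μ) :=
        ENNReal.ofReal_le_ofReal (integral_mono hf hf.pos_part fun x => le_max_left _ _)
    _ = ∫⁻ x in s, ENNReal.ofReal (max (f x) 0) ∂μ :=
        ofReal_integral_eq_lintegral_ofReal hf.pos_part
          (Filter.Eventually.of_forall fun x => le_max_right _ _)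
    _ ≤ _ := by
        refine setLIntegral_mono' hs fun x hx => ?_
        rw [ENNReal.ofReal_max, ENNReal.ofReal_zero, max_eq_left zero_le]
        exact ENNReal.ofReal_le_ofReal (hfg x hx)

theorem theorem1p3 (U K : Set S3) (hU : IsOpen U) (hK : IsCompact K) (hKU : K ⊆ U)
    (v H : S3 → E4) (hv : IsUnitVectorFieldOn v U) (hH : IsHopfField H)
    (hvH : ∀ x ∈ frontier K, v x = H x) :
    volField H K ≤ volField v K ∧ energyField H K ≤ energyField v K := by
  have hHU : IsUnitVectorFieldOn H U :=
    ⟨hH.isUnitVectorFieldOn.smooth.mono (subset_univ U),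
      fun x _ => hH.isUnitVectorFieldOn.tangent x (mem_univ x),
      fun x _ => hH.isUnitVectorFieldOn.unit x (mem_univ x)⟩
  have hσ : IntegrableOn (fun x : S3 => sigmaField v x) K volS3 :=
    ((continuousOn_sigmaField hU hv).mono hKU).integrableOn_compact hK
  have hint : ∫ x in K, sigmaField v x ∂volS3 = volS3.real K * 2 := by
    rw [setIntegral_sigmaField_eq hU hK hKU hv hHU hvH]
    simp [(hH.density _).2.2]
  have hconst : ∫⁻ _ in K, ENNReal.ofReal 2 ∂volS3 = ENNReal.ofReal (volS3.real K * 2) := by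
    rw [setLIntegral_const, ENNReal.ofReal_mul measureReal_nonneg, ofReal_measureReal, mul_comm]
  constructor
  · simp only [volField, (hH.density _).1, hconst]
    refine le_trans (le_of_eq ?_) (ofReal_setIntegral_le_setLIntegral hK.measurableSet
      (f := fun x => 1 + sigmaField v x / 2) ((integrable_const _).add (hσ.div_const 2))
      fun x hx => (hv.density_bounds hU (hKU hx)).1)
    rw [integral_add (integrable_const _) (hσ.div_const 2), integral_div, hint]
    congr 1
    simp [mul_two]
  · simp only [energyField, (hH.density _).2.1, hconst, ← hint]
    gcongr
    exact ofReal_setIntegral_le_setLIntegral hK.measurableSet hσ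
      fun x hx => (hv.density_bounds hU (hKU hx)).2
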